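/- All digraphs are finite, without loops or parallel edges; a digraph is acyclic if it has no directed cycle, and a dipath is a directed path. Let $G$ be an acyclic digraph, let $S=\{s_1,\dots,s_k\}$ be its set of sources (vertices of in-degree zero) and $T=\{t_1,\dots,t_\ell\}$ its set of sinks (vertices of out-degree zero), where $s_1,\dots,s_k$ are distinct and $t_1,\dots,t_\ell$ are distinct. Suppose that $S\cap T=\emptyset$, and that every vertex not in $S\cup T$ has in-degree and out-degree both at least two. Then exactly one of the following holds: (i) there are a dipath $P$ from $s_i$ to $t_j$ and a dipath $P'$ from $s_{i'}$ to $t_{j'}$, for some $i,i'\in\{1,\dots,k\}$ and $j,j'\in\{1,\dots,\ell\}$, such that $P,P'$ are vertex-disjoint and either $i<i'$ and $j>j'$, or $i>i'$ and $j<j'$; (ii) $G$ can be drawn without crossings in a closed disc with $s_1,s_2,\dots,s_k,t_\ell,t_{\ell-1},\dots,t_1$ drawn in the boundary of the disc in that (cyclic) order. (In a drawing, vertices are represented by distinct points of the disc, each edge by a simple arc in the disc joining its two ends and otherwise disjoint from the vertices, and arcs of different edges meet only at common ends.) -/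

import Mathlib

namespace Digraph

variable {V : Type*}

/-- The list `c = [v₀, …, vₙ]` of distinct vertices is the vertex sequence of a directed cycle:
there are edges `v₀ → v₁ → ⋯ → vₙ → v₀`. (A list of length one is a loop, a list of length two
a pair of antiparallel edges.) -/
def IsDicycle (G : Digraph V) (c : List V) : Prop :=
  c.Nodup ∧ c.IsChain G.Adj ∧ ∃ h : c ≠ [], G.Adj (c.getLast h) (c.head h)

/-- A digraph is acyclic if it has no directed cycle (in particular it has no loop). -/
def Acyclic (G : Digraph V) : Prop :=
  ∀ c : List V, ¬ G.IsDicycle c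

/-- The list `p` of distinct vertices is the vertex sequence of a directed path from `u` to `v`. -/
def IsDipath (G : Digraph V) (u v : V) (p : List V) : Prop :=
  p.Nodup ∧ p.IsChain G.Adj ∧ ∃ h : p ≠ [], p.head h = u ∧ p.getLast h = v

/-- The in-degree of a vertex. -/
noncomputable def inDeg (G : Digraph V) (v : V) : ℕ := {u | G.Adj u v}.ncard

/-- The out-degree of a vertex. -/
noncomputable def outDeg (G : Digraph V) (v : V) : ℕ := {w | G.Adj v w}.ncard

/-- The set of sources: the vertices with no in-neighbour. -/
def sources (G : Digraph V) : Set V := {v | ∀ u, ¬ G.Adj u v}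

/-- The set of sinks: the vertices with no out-neighbour. -/
def sinks (G : Digraph V) : Set V := {v | ∀ w, ¬ G.Adj v w}

/-- There is a cross in `G` relative to the sequences `s` and `t`: vertex-disjoint dipaths, one
from `s i` to `t j` and the other from `s i'` to `t j'`, with `i < i'` and `j > j'`, or
with `i > i'` and `j < j'`. -/
def HasCross (G : Digraph V) {k l : ℕ} (s : Fin k → V) (t : Fin l → V) : Prop :=
  ∃ (i i' : Fin k) (j j' : Fin l) (P P' : List V),
    G.IsDipath (s i) (t j) P ∧ G.IsDipath (s i') (t j') P' ∧ P.Disjoint P' ∧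
      ((i < i' ∧ j > j') ∨ (i > i' ∧ j < j'))

/-- A drawing of a loopless digraph in the closed unit disc of the plane: the vertices are distinct
points of the disc, every edge is a simple arc in the disc joining its two ends, no arc passes
through a vertex in its interior, and the interiors of the arcs of different edges are disjoint. -/
structure DiscDrawing (G : Digraph V) where
  /-- the point that represents a vertex -/
  pos : V → ℂ
  /-- the arc that represents an edge -/
  arc : ∀ u v : V, G.Adj u v → Path (pos u) (pos v)
  pos_mem : ∀ v, pos v ∈ Metric.closedBall (0 : ℂ) 1
  pos_injective : Function.Injective pos
  arc_mem : ∀ u v (h : G.Adj u v) (x : unitInterval), arc u v h x ∈ Metric.closedBall (0 : ℂ) 1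
  arc_injective : ∀ u v (h : G.Adj u v), Function.Injective (arc u v h)
  arc_ne_pos : ∀ u v (h : G.Adj u v), ∀ x ∈ Set.Ioo (0 : unitInterval) 1, ∀ w : V,
    arc u v h x ≠ pos w
  arc_disjoint : ∀ u v (h : G.Adj u v) u' v' (h' : G.Adj u' v'), (u, v) ≠ (u', v') →
    ∀ x ∈ Set.Ioo (0 : unitInterval) 1, ∀ y ∈ Set.Ioo (0 : unitInterval) 1,
      arc u v h x ≠ arc u' v' h' y

end Digraph

/-- The points `p 0, …, p (n - 1)` are distinct points on the unit circle that occur on it in this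
order, in one of the two directions (counterclockwise or clockwise), in less than one full turn. -/
def InBoundaryOrder {n : ℕ} (p : Fin n → ℂ) : Prop :=
  ∃ θ : Fin n → ℝ, (StrictMono θ ∨ StrictAnti θ) ∧ (∀ i j, |θ i - θ j| < 2 * Real.pi) ∧
    ∀ i, p i = Complex.exp (θ i * Complex.I)

/-- `G` can be drawn in a closed disc with the vertices `b 0, …, b (n - 1)` drawn in the boundary
in order. -/
def Digraph.DrawableInDisc {V : Type*} (G : Digraph V) {n : ℕ} (b : Fin n → V) : Prop :=
  ∃ D : G.DiscDrawing, InBoundaryOrder fun i => D.pos (b i)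

/-! The two alternatives exclude each other by planarity of the disc. In a drawing with the
prescribed boundary order, the two dipaths of a cross would trace disjoint paths in the disc whose
ends interleave on the circle. This is impossible (`exists_eq_of_interleaved`): if p(x) - q(y) never
vanished, it would have a continuous logarithm on the square of parameters, but its argument changes
by 2π in absolute value around the boundary of the square.

If there is no cross, a drawing is built by induction on the number of inner vertices
(`Layered.exists_stripDrawing`), in a strip with the sources on the upper side and the sinks on the
lower side at given coordinates. Take an inner vertex v of least rank, so that all its in-neighbours
are sources, and let a and b be the extreme ones. As out-degrees are at least two, any two distinct
vertices that are not sources start disjoint walks to the sinks. So a source strictly between a and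
b with an out-neighbour other than v would give a crossing (`Layered.eq_of_between`). Hence the
edges into v and all sources strictly between a and b can be removed, with v becoming a source in
their place, and no crossing appears. To return, the upper side is dented between a and b, which
lowers v, and the removed sources and edges are drawn straight above the dent
(`StripDrawing.exists_extend`). Finally the strip is mapped injectively into the disc. -/

/-! ### Paths in the disc with interleaved ends -/

/-- The change along a line of a continuous logarithm of a function with values in the half plane
`0 ≤ Re (z / a)`. -/
theorem Complex.continuous_log_sub_im_eq {L g : ℝ → ℂ} {a : ℂ} (ha : a ≠ 0) (hL : Continuous L)
    (hg : Continuous g) (hLg : ∀ t, Complex.exp (L t) = g t) (hre : ∀ t, 0 ≤ (g t / a).re)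
    (x y : ℝ) :
    (L y).im - (L x).im = Complex.arg (g y / a) - Complex.arg (g x / a) := by
  have hne : ∀ t, g t / a ≠ 0 := fun t => div_ne_zero (hLg t ▸ Complex.exp_ne_zero _) ha
  have hslit : ∀ t, g t / a ∈ Complex.slitPlane := by
    intro t
    rw [Complex.mem_slitPlane_iff]
    rcases (hre t).lt_or_eq with h | h
    · exact Or.inl h
    · exact Or.inr fun h' => hne t (Complex.ext h.symm h')
  have hlog : Continuous fun t => Complex.log (g t / a) :=
    (hg.div_const a).clog hslit
  -- Both sides are lifts of `g` through the covering map exp, and they agree at `x`.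
  have key := Complex.isCoveringMap_exp.eq_of_comp_eq hL
    (hlog.add (continuous_const (y := L x - Complex.log (g x / a)))) (by
      funext t
      apply Subtype.ext
      simp only [Function.comp_apply, Pi.add_apply, Complex.exp_add, Complex.exp_sub, hLg,
        Complex.exp_log (hne _)]
      have := hne x
      have h2 : g x ≠ 0 := hLg x ▸ Complex.exp_ne_zero _
      field_simp) x (by simp)
  have := congrArg Complex.im (congrFun key y)
  simp only [Pi.add_apply, Complex.add_im, Complex.sub_im, Complex.log_im] at this
  linarith

/-- In polar form, 1 - e^{iθ} = 2 sin(θ/2) e^{i(θ-π)/2}. -/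
theorem Complex.arg_one_sub_exp_mul_I {θ : ℝ} (h0 : 0 < θ) (h1 : θ < 2 * Real.pi) :
    Complex.arg (1 - Complex.exp (θ * Complex.I)) = (θ - Real.pi) / 2 := by
  have hs : 0 < 2 * Real.sin (θ / 2) := by
    have := Real.sin_pos_of_pos_of_lt_pi (x := θ / 2) (by linarith) (by linarith)
    linarith
  rw [← Complex.arg_mul_cos_add_sin_mul_I hs (θ := (θ - Real.pi) / 2)
    ⟨by linarith, by linarith [Real.pi_pos]⟩]
  congr 1
  have h2 : (θ - Real.pi) / 2 = θ / 2 - Real.pi / 2 := by ring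
  rw [← Complex.ofReal_cos, ← Complex.ofReal_sin, h2, Real.cos_sub_pi_div_two,
    Real.sin_sub_pi_div_two, Complex.exp_mul_I, ← Complex.ofReal_cos, ← Complex.ofReal_sin]
  have h3 : Real.cos θ = 1 - 2 * Real.sin (θ / 2) ^ 2 := by
    rw [← Real.cos_sq_add_sin_sq (θ / 2)]
    have := Real.cos_two_mul (θ / 2)
    rw [show 2 * (θ / 2) = θ by ring] at this
    linarith [Real.cos_sq_add_sin_sq (θ / 2)]
  have h4 : Real.sin θ = 2 * Real.sin (θ / 2) * Real.cos (θ / 2) := by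
    rw [← Real.sin_two_mul]; ring_nf
  rw [h3, h4]
  push_cast
  ring

theorem Complex.arg_exp_sub_div {θ φ : ℝ} (h0 : θ < φ) (h1 : φ - θ < 2 * Real.pi) :
    Complex.arg ((Complex.exp (θ * Complex.I) - Complex.exp (φ * Complex.I)) /
      Complex.exp (θ * Complex.I)) = (φ - θ - Real.pi) / 2 ∧
    Complex.arg ((Complex.exp (φ * Complex.I) - Complex.exp (θ * Complex.I)) /
      Complex.exp (φ * Complex.I)) = -(φ - θ - Real.pi) / 2 := by
  rw [sub_div _ _ (Complex.exp (θ * Complex.I)), div_self (Complex.exp_ne_zero _),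
    ← Complex.exp_sub, ← sub_mul, ← Complex.ofReal_sub, sub_div _ _ (Complex.exp (φ * Complex.I)),
    div_self (Complex.exp_ne_zero _), ← Complex.exp_sub, ← sub_mul, ← Complex.ofReal_sub]
  refine ⟨Complex.arg_one_sub_exp_mul_I (by linarith) h1, ?_⟩
  have := Complex.arg_one_sub_exp_mul_I (θ := θ - φ + 2 * Real.pi) (by linarith) (by linarith)
  have e : Complex.exp (((θ - φ + 2 * Real.pi : ℝ) : ℂ) * Complex.I)
      = Complex.exp (((θ - φ : ℝ) : ℂ) * Complex.I) := by
    rw [Complex.exp_eq_exp_iff_exists_int]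
    exact ⟨1, by push_cast; ring⟩
  rw [e] at this
  rw [this]
  ring

/-- The disc lies on one side of its tangent at a. This is what keeps the argument single-valued on
each side of the parameter square. -/
theorem Complex.re_sub_div_nonneg {a z : ℂ} (ha : ‖a‖ = 1) (hz : ‖z‖ ≤ 1) :
    0 ≤ ((a - z) / a).re := by
  have h0 : a ≠ 0 := by rintro rfl; simp at ha
  rw [sub_div, div_self h0, Complex.sub_re, Complex.one_re]
  have := Complex.re_le_norm (z / a)
  rw [norm_div, ha, div_one] at this
  linarith

/-- Two paths in the closed unit disc whose ends interleave on the unit circle meet. -/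
theorem exists_eq_of_interleaved {α β γ δ : ℝ} (h₁ : α < γ) (h₂ : γ < β) (h₃ : β < δ)
    (h₄ : δ - α < 2 * Real.pi)
    (p : Path (Complex.exp (α * Complex.I)) (Complex.exp (β * Complex.I)))
    (q : Path (Complex.exp (γ * Complex.I)) (Complex.exp (δ * Complex.I)))
    (hp : ∀ x, p x ∈ Metric.closedBall (0 : ℂ) 1) (hq : ∀ x, q x ∈ Metric.closedBall (0 : ℂ) 1) :
    ∃ x y, p x = q y := by
  by_contra! hne
  have hp' : ∀ x, ‖p.extend x‖ ≤ 1 := fun x => by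
    simpa [Path.extend, Set.IccExtend] using hp _
  have hq' : ∀ x, ‖q.extend x‖ ≤ 1 := fun x => by
    simpa [Path.extend, Set.IccExtend] using hq _
  have hne' : ∀ x y, p.extend x - q.extend y ≠ 0 := fun x y => by
    simpa [Path.extend, Set.IccExtend] using sub_ne_zero.2 (hne _ _)
  have hsc : IsSimplyConnected (Set.univ : Set (ℝ × ℝ)) := by
    have := (convex_univ (𝕜 := ℝ) (E := ℝ × ℝ)).contractibleSpace Set.univ_nonempty
    exact (inferInstance : SimplyConnectedSpace (Set.univ : Set (ℝ × ℝ)))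
  obtain ⟨L, hLc, hL⟩ := Complex.exists_continuousOn_eqOn_exp_comp (X := ℝ × ℝ)
    (U := Set.univ) hsc isOpen_univ
    (g := fun z => p.extend z.1 - q.extend z.2)
    (by fun_prop) (by simpa using fun x y => hne' x y)
  rw [continuousOn_univ] at hLc
  have hL' : ∀ x y, Complex.exp (L (x, y)) = p.extend x - q.extend y := fun x y =>
    hL (Set.mem_univ (x, y))
  have hn : ∀ θ : ℝ, ‖Complex.exp (θ * Complex.I)‖ = 1 := Complex.norm_exp_ofReal_mul_I
  have h0 : ∀ θ : ℝ, Complex.exp (θ * Complex.I) ≠ 0 := fun θ => Complex.exp_ne_zero _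
  have hneg : ∀ {z a : ℂ}, (z - a) / -a = (a - z) / a := fun {z a} => by
    rw [div_neg, ← neg_div, neg_sub]
  have e1 := Complex.continuous_log_sub_im_eq (h0 α) (L := fun y => L (0, y))
    (g := fun y => p.extend 0 - q.extend y) (by fun_prop) (by fun_prop) (fun y => hL' 0 y)
    (fun y => by
      rw [Path.extend_zero]; exact Complex.re_sub_div_nonneg (hn α) (hq' y)) 0 1
  have e2 := Complex.continuous_log_sub_im_eq (h0 β) (L := fun y => L (1, y))
    (g := fun y => p.extend 1 - q.extend y) (by fun_prop) (by fun_prop) (fun y => hL' 1 y)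
    (fun y => by
      rw [Path.extend_one]; exact Complex.re_sub_div_nonneg (hn β) (hq' y)) 0 1
  have e3 := Complex.continuous_log_sub_im_eq (neg_ne_zero.2 (h0 γ)) (L := fun x => L (x, 0))
    (g := fun x => p.extend x - q.extend 0) (by fun_prop) (by fun_prop) (fun x => hL' x 0)
    (fun x => by
      rw [Path.extend_zero, hneg]; exact Complex.re_sub_div_nonneg (hn γ) (hp' x)) 0 1
  have e4 := Complex.continuous_log_sub_im_eq (neg_ne_zero.2 (h0 δ)) (L := fun x => L (x, 1))
    (g := fun x => p.extend x - q.extend 1) (by fun_prop) (by fun_prop) (fun x => hL' x 1)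
    (fun x => by
      rw [Path.extend_one, hneg]; exact Complex.re_sub_div_nonneg (hn δ) (hp' x)) 0 1
  -- On each side of the square one path rests at a boundary point, so the change of `L.im` is a
  -- difference of two explicit arguments.
  simp only [Path.extend_zero, Path.extend_one, hneg] at e1 e2 e3 e4
  rw [(Complex.arg_exp_sub_div (by linarith) (by linarith)).1,
    (Complex.arg_exp_sub_div (by linarith) (by linarith)).1] at e1
  rw [(Complex.arg_exp_sub_div (by linarith) (by linarith)).1,
    (Complex.arg_exp_sub_div (by linarith) (by linarith)).2] at e2
  rw [(Complex.arg_exp_sub_div (by linarith) (by linarith)).1,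
    (Complex.arg_exp_sub_div (by linarith) (by linarith)).2] at e3
  rw [(Complex.arg_exp_sub_div (by linarith) (by linarith)).2,
    (Complex.arg_exp_sub_div (by linarith) (by linarith)).2] at e4
  -- From (0,0) to (1,1), the way through (0,1) gives (β - α + δ - γ)/2, and the way through (1,0)
  -- gives 2π less.
  linarith [Real.pi_pos]

/-! ### A cross prevents a drawing -/

namespace Digraph

variable {V : Type*} {G : Digraph V}

/-- The points of the plane that a drawing uses for the vertices in `p` and the edges between
them. -/
def DiscDrawing.carrier (D : G.DiscDrawing) (p : List V) : Set ℂ :=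
  {z | (∃ w ∈ p, z = D.pos w) ∨
    ∃ u ∈ p, ∃ v ∈ p, ∃ h : G.Adj u v, ∃ x ∈ Set.Ioo (0 : unitInterval) 1, z = D.arc u v h x}

theorem DiscDrawing.carrier_mono (D : G.DiscDrawing) {p q : List V} (h : p ⊆ q) :
    D.carrier p ⊆ D.carrier q := by
  rintro z (⟨w, hw, rfl⟩ | ⟨u, hu, v, hv, h', x, hx, rfl⟩)
  · exact Or.inl ⟨w, h hw, rfl⟩
  · exact Or.inr ⟨u, h hu, v, h hv, h', x, hx, rfl⟩

theorem DiscDrawing.carrier_subset (D : G.DiscDrawing) (p : List V) :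
    D.carrier p ⊆ Metric.closedBall (0 : ℂ) 1 := by
  rintro z (⟨w, hw, rfl⟩ | ⟨u, hu, v, hv, h', x, hx, rfl⟩)
  · exact D.pos_mem w
  · exact D.arc_mem _ _ _ _

/-- Edges within `p` and within `q` have different tails, so they are different edges and their arcs
have disjoint interiors. -/
theorem DiscDrawing.carrier_disjoint (D : G.DiscDrawing) {p q : List V} (h : p.Disjoint q) :
    Disjoint (D.carrier p) (D.carrier q) := by
  rw [Set.disjoint_left]
  rintro z (⟨w, hw, rfl⟩ | ⟨u, hu, v, hv, h', x, hx, rfl⟩)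
    (⟨w', hw', e⟩ | ⟨u', hu', v', hv', h'', x', hx', e⟩)
  · exact h hw (D.pos_injective e ▸ hw')
  · exact D.arc_ne_pos _ _ _ _ hx' _ e.symm
  · exact D.arc_ne_pos _ _ _ _ hx _ e
  · refine D.arc_disjoint _ _ _ _ _ _ (fun e' => ?_) _ hx _ hx' e
    rw [Prod.mk.injEq] at e'
    exact h hu (e'.1 ▸ hu')

theorem DiscDrawing.exists_path (D : G.DiscDrawing) (p : List V) (u v : V)
    (hp : p.IsChain G.Adj) (hu : p.head? = some u) (hv : p.getLast? = some v) :
    ∃ γ : Path (D.pos u) (D.pos v), Set.range γ ⊆ D.carrier p := by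
  induction p generalizing u with
  | nil => simp at hu
  | cons a p ih =>
    obtain rfl : a = u := by simpa using hu
    cases p with
    | nil =>
      obtain rfl : a = v := by simpa using hv
      refine ⟨Path.refl _, ?_⟩
      rintro _ ⟨x, rfl⟩
      exact Or.inl ⟨a, by simp, rfl⟩
    | cons b p =>
      rw [List.isChain_cons_cons] at hp
      obtain ⟨γ, hγ⟩ := ih b hp.2 rfl (by simpa [List.getLast?_cons_cons] using hv)
      refine ⟨(D.arc a b hp.1).trans γ, ?_⟩
      rw [Path.trans_range]
      refine Set.union_subset ?_ (hγ.trans (D.carrier_mono (by simp)))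
      rintro _ ⟨x, rfl⟩
      by_cases h0 : x = 0
      · exact Or.inl ⟨a, by simp, by simp [h0]⟩
      by_cases h1 : x = 1
      · exact Or.inl ⟨b, by simp, by simp [h1]⟩
      · exact Or.inr ⟨a, by simp, b, by simp, hp.1, x,
          ⟨unitInterval.pos_iff_ne_zero.2 h0, unitInterval.lt_one_iff_ne_one.2 h1⟩, rfl⟩

theorem IsDipath.head?_eq {u v : V} {p : List V} (h : G.IsDipath u v p) : p.head? = some u := by
  obtain ⟨-, -, h0, h1, -⟩ := h
  rw [List.head?_eq_some_head h0, h1]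

theorem IsDipath.getLast?_eq {u v : V} {p : List V} (h : G.IsDipath u v p) :
    p.getLast? = some v := by
  obtain ⟨-, -, h0, -, h1⟩ := h
  rw [List.getLast?_eq_some_getLast h0, h1]

/-- Disjoint dipaths do not cross in a drawing in the disc. -/
theorem DrawableInDisc.not_interleaved {n : ℕ} {b : Fin n → V} (hb : G.DrawableInDisc b)
    {i i' j j' : Fin n} (h₁ : i < i') (h₂ : i' < j) (h₃ : j < j') {P P' : List V}
    (hP : G.IsDipath (b i) (b j) P) (hP' : G.IsDipath (b i') (b j') P') : ¬ P.Disjoint P' := by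
  intro hd
  obtain ⟨D, θ, hθ, hlt, hpos⟩ := hb
  obtain ⟨p, hp⟩ := D.exists_path P _ _ hP.2.1 hP.head?_eq hP.getLast?_eq
  obtain ⟨q, hq⟩ := D.exists_path P' _ _ hP'.2.1 hP'.head?_eq hP'.getLast?_eq
  have hpq : ∀ x y, p x ≠ q y := fun x y e =>
    Set.disjoint_left.1 (D.carrier_disjoint hd) (hp ⟨x, rfl⟩) (hq ⟨y, e.symm⟩)
  have hpm : ∀ x, p x ∈ Metric.closedBall (0 : ℂ) 1 := fun x =>
    D.carrier_subset _ (hp ⟨x, rfl⟩)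
  have hqm : ∀ x, q x ∈ Metric.closedBall (0 : ℂ) 1 := fun x =>
    D.carrier_subset _ (hq ⟨x, rfl⟩)
  rcases hθ with hθ | hθ
  · obtain ⟨x, y, e⟩ := exists_eq_of_interleaved (hθ h₁) (hθ h₂) (hθ h₃)
      ((le_abs_self _).trans_lt (hlt _ _)) (p.cast (hpos i).symm (hpos j).symm)
      (q.cast (hpos i').symm (hpos j').symm) hpm hqm
    exact hpq x y e
  -- In the clockwise case the angles increase in the order j', j, i', i, so both paths are reversed
  -- and their roles swapped.
  · obtain ⟨x, y, e⟩ := exists_eq_of_interleaved (hθ h₃) (hθ h₂) (hθ h₁)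
      ((le_abs_self _).trans_lt (hlt _ _)) (q.symm.cast (hpos j').symm (hpos i').symm)
      (p.symm.cast (hpos j).symm (hpos i).symm) (fun x => hqm _) (fun x => hpm _)
    exact hpq _ _ e.symm

/-- The sinks are listed in reverse, so j' < j puts `t j` before `t j'`, and the ends of the two
dipaths interleave. -/
theorem HasCross.not_drawableInDisc {k l : ℕ} {s : Fin k → V} {t : Fin l → V}
    (h : G.HasCross s t) :
    ¬ G.DrawableInDisc (Fin.append s (fun j => t (Fin.rev j))) := by
  have main : ∀ (i i' : Fin k) (j j' : Fin l) (P P' : List V), G.IsDipath (s i) (t j) P →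
      G.IsDipath (s i') (t j') P' → P.Disjoint P' → i < i' → j' < j →
      ¬ G.DrawableInDisc (Fin.append s (fun j => t (Fin.rev j))) := by
    intro i i' j j' P P' hP hP' hd hi hj hD
    refine hD.not_interleaved (i := Fin.castAdd l i) (i' := Fin.castAdd l i')
      (j := Fin.natAdd k j.rev) (j' := Fin.natAdd k j'.rev) (Fin.strictMono_castAdd l hi)
      ?_ (by simpa using hj) (P := P) (P' := P') (by simpa using hP) (by simpa using hP') hd
    rw [Fin.lt_def, Fin.val_castAdd, Fin.val_natAdd]
    omega
  obtain ⟨i, i', j, j', P, P', hP, hP', hd, h | h⟩ := h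
  · exact main i i' j j' P P' hP hP' hd h.1 h.2
  · exact main i' i j' j P' P hP' hP hd.symm h.1 h.2

end Digraph
-- Walks and layered relations
/-- The list `p` is the vertex sequence of a walk of the relation `E` from `u` to `v`. -/
def IsWalk {V : Type*} (E : V → V → Prop) (u v : V) (p : List V) : Prop :=
  p.IsChain E ∧ p.head? = some u ∧ p.getLast? = some v

namespace IsWalk

variable {V : Type*} {E : V → V → Prop} {u v w : V} {p : List V}

theorem singleton (u : V) : IsWalk E u u [u] := ⟨by simp, rfl, rfl⟩

theorem cons (h : E u v) (hp : IsWalk E v w p) : IsWalk E u w (u :: p) := by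
  obtain ⟨h1, h2, h3⟩ := hp
  cases p with
  | nil => simp at h2
  | cons a p =>
    obtain rfl : a = v := by simpa using h2
    exact ⟨List.isChain_cons_cons.2 ⟨h, h1⟩, rfl, by rwa [List.getLast?_cons_cons]⟩

theorem mono {F : V → V → Prop} (h : ∀ u v, E u v → F u v) (hp : IsWalk E u v p) :
    IsWalk F u v p :=
  ⟨hp.1.imp h, hp.2⟩

theorem head_mem (hp : IsWalk E u v p) : u ∈ p := List.mem_of_head? hp.2.1

theorem last_mem (hp : IsWalk E u v p) : v ∈ p := List.mem_of_getLast? hp.2.2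

end IsWalk

/-- The relation `E` on `S ∪ I ∪ T` has no edge into `S` and none out of `T`, increases the rank
`r`, and the vertices in `I` have in-degree and out-degree at least two. -/
structure Layered {V : Type*} (E : V → V → Prop) (S I T : Set V) (r : V → ℕ) : Prop where
  tail_mem : ∀ {u v}, E u v → u ∈ S ∨ u ∈ I
  head_mem : ∀ {u v}, E u v → v ∈ I ∨ v ∈ T
  lt : ∀ {u v}, E u v → r u < r v
  disjoint_SI : Disjoint S I
  disjoint_ST : Disjoint S T
  disjoint_IT : Disjoint I T
  two_in : ∀ {v}, v ∈ I → ∃ u u', u ≠ u' ∧ E u v ∧ E u' v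
  two_out : ∀ {v}, v ∈ I → ∃ w w', w ≠ w' ∧ E v w ∧ E v w'

/-- There are no disjoint walks from `S` to `T` whose ends are in opposite orders with respect to
the coordinates `σ` and `τ`. -/
def NoCrossing {V : Type*} (E : V → V → Prop) (S T : Set V) (σ τ : V → ℝ) : Prop :=
  ∀ s ∈ S, ∀ s' ∈ S, ∀ t ∈ T, ∀ t' ∈ T, ∀ p p', IsWalk E s t p → IsWalk E s' t' p' →
    p.Disjoint p' → σ s < σ s' → τ t ≤ τ t'

namespace Layered

variable {V : Type*} {E : V → V → Prop} {S I T : Set V} {r : V → ℕ}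

theorem notMem_S (hL : Layered E S I T r) {v : V} (h : v ∈ I ∨ v ∈ T) : v ∉ S := fun hv =>
  h.elim (Set.disjoint_left.1 hL.disjoint_SI hv) (Set.disjoint_left.1 hL.disjoint_ST hv)

theorem notMem_T (hL : Layered E S I T r) {v : V} (h : v ∈ S ∨ v ∈ I) : v ∉ T := fun hv =>
  h.elim (fun h => Set.disjoint_left.1 hL.disjoint_ST h hv)
    (fun h => Set.disjoint_left.1 hL.disjoint_IT h hv)

/-- Every later vertex is entered by an edge, so its rank is larger and it is not in `S`. This
yields most of the disjointness claims below. -/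
theorem eq_or_of_mem_walk (hL : Layered E S I T r) {u v z : V} {p : List V}
    (hp : IsWalk E u v p) (hz : z ∈ p) :
    z = u ∨ (r u < r z ∧ u ∉ T ∧ (z ∈ I ∨ z ∈ T)) := by
  induction p generalizing u with
  | nil => simp at hz
  | cons a p ih =>
    obtain ⟨h1, h2, h3⟩ := hp
    obtain rfl : a = u := by simpa using h2
    rcases List.mem_cons.1 hz with rfl | hz
    · exact Or.inl rfl
    cases p with
    | nil => simp at hz
    | cons b p =>
      rw [List.isChain_cons_cons] at h1
      have hT := hL.notMem_T (hL.tail_mem h1.1)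
      have hlt := hL.lt h1.1
      rw [List.getLast?_cons_cons] at h3
      rcases ih ⟨h1.2, rfl, h3⟩ hz with rfl | ⟨h, -, h'⟩
      · exact Or.inr ⟨hlt, hT, hL.head_mem h1.1⟩
      · exact Or.inr ⟨hlt.trans h, hT, h'⟩

/-- From two distinct vertices outside `S` there are disjoint walks to `T`. -/
theorem exists_disjoint_walks [Finite V] (hL : Layered E S I T r) {x y : V}
    (hx : x ∈ I ∨ x ∈ T) (hy : y ∈ I ∨ y ∈ T) (hxy : x ≠ y) :
    ∃ t ∈ T, ∃ t' ∈ T, ∃ p p', IsWalk E x t p ∧ IsWalk E y t' p' ∧ p.Disjoint p' := by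
  obtain ⟨R, hR⟩ : ∃ R, ∀ v, r v ≤ R := by
    obtain ⟨R, hR⟩ := (Set.finite_range r).bddAbove
    exact ⟨R, fun v => hR ⟨v, rfl⟩⟩
  obtain ⟨n, hn⟩ : ∃ n, (R - r x) + (R - r y) < n := ⟨_, Nat.lt_succ_self _⟩
  induction n generalizing x y with
  | zero => omega
  | succ n ih =>
    -- Advance the vertex of smaller rank, or the only one not yet in `T`, to an out-neighbour
    -- different from the other vertex. The vertex left behind cannot lie on the other walk, where
    -- ranks increase.
    have adv : ∀ {x y : V}, x ∈ I → (y ∈ I ∨ y ∈ T) → x ≠ y → (R - r x) + (R - r y) < n + 1 →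
        (y ∈ T ∨ r x ≤ r y) →
        ∃ t ∈ T, ∃ t' ∈ T, ∃ p p', IsWalk E x t p ∧ IsWalk E y t' p' ∧ p.Disjoint p' := by
      intro x y hx hy hxy hn h
      obtain ⟨w, hw, hxw⟩ : ∃ w, w ≠ y ∧ E x w := by
        obtain ⟨w, w', hne, hw, hw'⟩ := hL.two_out hx
        by_cases e : w = y
        · exact ⟨w', fun e' => hne (e.trans e'.symm), hw'⟩
        · exact ⟨w, e, hw⟩
      have hlt := hL.lt hxw
      have hRw := hR w
      obtain ⟨t, ht, t', ht', p, p', hp, hp', hd⟩ := ih (hL.head_mem hxw) hy hw (by omega)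
      refine ⟨t, ht, t', ht', x :: p, p', hp.cons hxw, hp', ?_⟩
      rw [List.disjoint_cons_left]
      refine ⟨fun hxp => ?_, hd⟩
      rcases hL.eq_or_of_mem_walk hp' hxp with e | ⟨hlt', hyT, -⟩
      · exact hxy e
      · exact h.elim hyT (fun h => by omega)
    have advy : y ∈ I → (x ∈ T ∨ r y ≤ r x) →
        ∃ t ∈ T, ∃ t' ∈ T, ∃ p p', IsWalk E x t p ∧ IsWalk E y t' p' ∧ p.Disjoint p' := by
      intro hy h
      obtain ⟨t, ht, t', ht', p, p', hp, hp', hd⟩ := adv hy hx hxy.symm (by omega) h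
      exact ⟨t', ht', t, ht, p', p, hp', hp, hd.symm⟩
    rcases hx with hxI | hxT
    · rcases hy with hyI | hyT
      · rcases le_total (r x) (r y) with h | h
        · exact adv hxI (Or.inl hyI) hxy hn (Or.inr h)
        · exact advy hyI (Or.inr h)
      · exact adv hxI (Or.inr hyT) hxy hn (Or.inl hyT)
    · rcases hy with hyI | hyT
      · exact advy hyI (Or.inl hxT)
      · exact ⟨x, hxT, y, hyT, [x], [y], .singleton x, .singleton y, by simpa using hxy.symm⟩

/-- A source strictly between two in-neighbours of `v` has no out-neighbour other than `v`. -/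
theorem eq_of_between [Finite V] (hL : Layered E S I T r) {σ τ : V → ℝ}
    (hτ : Set.InjOn τ T) (hE : NoCrossing E S T σ τ) {v a b m w : V} (hv : v ∈ I)
    (haS : a ∈ S) (hbS : b ∈ S) (hmS : m ∈ S) (ha : E a v) (hb : E b v) (hw : E m w)
    (ham : σ a < σ m) (hmb : σ m < σ b) : w = v := by
  by_contra hne
  -- The walk from `w` is extended back to `m`, and the one from `v` to either `a` or `b`. These two
  -- choices force τ t' ≤ τ t and τ t ≤ τ t', so the disjoint walks would share their end.
  obtain ⟨t, ht, t', ht', p, p', hp, hp', hd⟩ :=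
    hL.exists_disjoint_walks (hL.head_mem hw) (Or.inl hv) hne
  have hS : ∀ {x y z q}, x ∈ S → (y ∈ I ∨ y ∈ T) → IsWalk E y z q → x ∉ q := by
    intro x y z q hx hy hq hxq
    rcases hL.eq_or_of_mem_walk hq hxq with rfl | ⟨-, -, h⟩
    · exact hL.notMem_S hy hx
    · exact hL.notMem_S h hx
  have hdis : ∀ {x}, x ∈ S → x ≠ m → (x :: p').Disjoint (m :: p) := by
    intro x hx hxm
    rw [List.disjoint_cons_left, List.disjoint_cons_right, List.mem_cons]
    exact ⟨fun h => h.elim hxm (hS hx (hL.head_mem hw) hp), hS hmS (Or.inl hv) hp', hd.symm⟩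
  have h1 := hE a haS m hmS t' ht' t ht _ _ (hp'.cons ha) (hp.cons hw)
    (hdis haS (fun e => by simp [e] at ham)) ham
  have h2 := hE m hmS b hbS t ht t' ht' _ _ (hp.cons hw) (hp'.cons hb)
    (hdis hbS (fun e => by simp [e] at hmb)).symm hmb
  exact hd hp.last_mem (hτ ht' ht (le_antisymm h1 h2) ▸ hp'.last_mem)

/-- Deleting the edges into a vertex `v` that is first in the rank makes it a source that replaces
the sources between its extreme in-neighbours. -/
theorem delete_edges [Finite V] (hL : Layered E S I T r) {σ τ : V → ℝ}
    (hτ : Set.InjOn τ T) (hE : NoCrossing E S T σ τ) {v a b : V} (hv : v ∈ I)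
    (hin : ∀ u, E u v → u ∈ S) (ha : E a v) (hb : E b v) :
    Layered (fun x y => E x y ∧ y ≠ v) (insert v {s ∈ S | ¬ (σ a < σ s ∧ σ s < σ b)})
      (I \ {v}) T r where
  -- A dropped source has no edge left, since its only possible out-neighbour was `v`.
  tail_mem {u w} h := by
    by_cases huv : u = v
    · exact Or.inl (Or.inl huv)
    rcases hL.tail_mem h.1 with hu | hu
    · exact Or.inl (Or.inr ⟨hu, fun hab => h.2
        (hL.eq_of_between hτ hE hv (hin a ha) (hin b hb) hu ha hb h.1 hab.1 hab.2)⟩)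
    · exact Or.inr ⟨hu, huv⟩
  head_mem {u w} h := (hL.head_mem h.1).imp_left fun hw => ⟨hw, h.2⟩
  lt h := hL.lt h.1
  disjoint_SI := by
    rw [Set.disjoint_left]
    rintro x (rfl | hx) hx'
    · exact hx'.2 rfl
    · exact Set.disjoint_left.1 hL.disjoint_SI hx.1 hx'.1
  disjoint_ST := by
    rw [Set.disjoint_left]
    rintro x (rfl | hx) hx'
    · exact Set.disjoint_left.1 hL.disjoint_IT hv hx'
    · exact Set.disjoint_left.1 hL.disjoint_ST hx.1 hx'
  disjoint_IT := hL.disjoint_IT.mono_left Set.sdiff_subset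
  two_in {w} hw := by
    obtain ⟨u, u', h, h1, h2⟩ := hL.two_in hw.1
    exact ⟨u, u', h, ⟨h1, hw.2⟩, ⟨h2, hw.2⟩⟩
  two_out {w} hw := by
    obtain ⟨u, u', h, h1, h2⟩ := hL.two_out hw.1
    have hwS := hL.notMem_S (Or.inl hw.1)
    exact ⟨u, u', h, ⟨h1, fun e => hwS (hin _ (e ▸ h1))⟩, ⟨h2, fun e => hwS (hin _ (e ▸ h2))⟩⟩

/-- A walk from `v` is pulled back to a source of the old relation: to `a` if the other walk starts
to the right of `c`, to `b` if it starts to the left. The order of the starts is kept. -/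
theorem noCrossing_delete_edges [DecidableEq V] (hL : Layered E S I T r) {σ τ : V → ℝ}
    (hE : NoCrossing E S T σ τ) {v a b : V} (hv : v ∈ I) {c : ℝ}
    (hin : ∀ u, E u v → u ∈ S) (ha : E a v) (hb : E b v) (hac : σ a < c) (hcb : c < σ b) :
    NoCrossing (fun x y => E x y ∧ y ≠ v) (insert v {s ∈ S | ¬ (σ a < σ s ∧ σ s < σ b)}) T
      (Function.update σ v c) τ := by
  have hvS : v ∉ S := hL.notMem_S (Or.inl hv)
  have hup : ∀ {s}, s ∈ S → Function.update σ v c s = σ s := fun {s} hs =>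
    Function.update_of_ne (fun e : s = v => hvS (e ▸ hs)) _ _
  have hnot : ∀ {x y z q}, x ∈ S → x ≠ y → IsWalk E y z q → x ∉ q := by
    intro x y z q hx hne hq hxq
    rcases hL.eq_or_of_mem_walk hq hxq with rfl | ⟨-, -, h⟩
    · exact hne rfl
    · exact hL.notMem_S h hx
  rintro s hs s' hs' t ht t' ht' p p' hp hp' hd hlt
  replace hp := hp.mono (F := E) fun _ _ h => h.1
  replace hp' := hp'.mono (F := E) fun _ _ h => h.1
  rcases hs with rfl | ⟨hs, hsn⟩ <;> rcases hs' with rfl | ⟨hs', hsn'⟩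
  · simp at hlt
  · rw [Function.update_self, hup hs'] at hlt
    have hlt' := hac.trans hlt
    refine hE a (hin a ha) s' hs' t ht t' ht' _ _ (hp.cons ha) hp' ?_ hlt'
    rw [List.disjoint_cons_left]
    exact ⟨hnot (hin a ha) (fun e => by simp [e] at hlt') hp', hd⟩
  · rw [Function.update_self, hup hs] at hlt
    have hlt' := hlt.trans hcb
    refine hE s hs b (hin b hb) t ht t' ht' _ _ hp (hp'.cons hb) ?_ hlt'
    rw [List.disjoint_cons_right]
    exact ⟨hnot (hin b hb) (fun e => by simp [e] at hlt') hp, hd⟩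
  · rw [hup hs, hup hs'] at hlt
    exact hE s hs s' hs' t ht t' ht' _ _ hp hp' hd hlt

end Layered

/-! ### Drawings in the strip -/

/-- A drawing of the relation `E` on the vertex set `A` in the strip `0 ≤ y ≤ 1` of the plane. -/
structure StripDrawing {V : Type*} (E : V → V → Prop) (A : Set V) where
  /-- the point that represents a vertex -/
  pos : V → ℝ × ℝ
  /-- the arc that represents an edge -/
  arc : V → V → unitInterval → ℝ × ℝ
  arc_continuous : ∀ {u v}, E u v → Continuous (arc u v)
  arc_zero : ∀ {u v}, E u v → arc u v 0 = pos u
  arc_one : ∀ {u v}, E u v → arc u v 1 = pos v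
  pos_injOn : Set.InjOn pos A
  pos_mem : ∀ {v}, v ∈ A → (pos v).2 ∈ Set.Icc (0 : ℝ) 1
  arc_mem : ∀ {u v}, E u v → ∀ x, (arc u v x).2 ∈ Set.Icc (0 : ℝ) 1
  arc_injective : ∀ {u v}, E u v → Function.Injective (arc u v)
  arc_ne_pos : ∀ {u v}, E u v → ∀ x ∈ Set.Ioo (0 : unitInterval) 1, ∀ w ∈ A, arc u v x ≠ pos w
  arc_disjoint : ∀ {u v}, E u v → ∀ {u' v'}, E u' v' → (u, v) ≠ (u', v') →
    ∀ x ∈ Set.Ioo (0 : unitInterval) 1, ∀ y ∈ Set.Ioo (0 : unitInterval) 1,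
      arc u v x ≠ arc u' v' y

/-- Straight segments draw a graph without inner vertices. -/
theorem Layered.exists_stripDrawing_of_empty {V : Type*} {E : V → V → Prop} {S T : Set V}
    {r : V → ℕ} (hL : Layered E S ∅ T r) {σ τ : V → ℝ} (hσ : Set.InjOn σ S) (hτ : Set.InjOn τ T)
    (hE : NoCrossing E S T σ τ) :
    ∃ D : StripDrawing E (S ∪ ∅ ∪ T),
      (∀ s ∈ S, D.pos s = (σ s, 1)) ∧ ∀ t ∈ T, D.pos t = (τ t, 0) := by
  classical
  have hS : ∀ {u v}, E u v → u ∈ S := fun h => (hL.tail_mem h).resolve_right id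
  have hT : ∀ {u v}, E u v → v ∈ T := fun h => (hL.head_mem h).resolve_left id
  have hTS : ∀ {v}, v ∈ T → v ∉ S := fun h => hL.notMem_S (Or.inr h)
  have hx1 : ∀ x : unitInterval, ((x : ℝ) = 0 ↔ x = 0) ∧ ((x : ℝ) = 1 ↔ x = 1) := fun x =>
    ⟨by rw [← Set.Icc.coe_zero, Subtype.coe_inj],
      by rw [← Set.Icc.coe_one, Subtype.coe_inj]⟩
  have posS : ∀ {v}, v ∈ S → (if v ∈ S then (σ v, (1 : ℝ)) else (τ v, 0)) = (σ v, 1) :=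
    fun h => if_pos h
  have posT : ∀ {v}, v ∈ T → (if v ∈ S then (σ v, (1 : ℝ)) else (τ v, 0)) = (τ v, 0) :=
    fun h => if_neg (hTS h)
  -- Segments that meet at an inner height have lower ends in the order opposite to their upper
  -- ends, so their edges are two crossing walks.
  have key : ∀ {u v}, E u v → ∀ {u' v'}, E u' v' → ∀ x ∈ Set.Ioo (0 : ℝ) 1,
      σ u + x * (τ v - σ u) = σ u' + x * (τ v' - σ u') → σ u < σ u' → False := by
    intro u v h u' v' h' x hx e hlt
    have hv : τ v' < τ v := by
      by_contra hv
      nlinarith [hx.1, hx.2]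
    refine hv.not_ge (hE u (hS h) u' (hS h') v (hT h) v' (hT h') [u, v] [u', v']
      ((IsWalk.singleton v).cons h) ((IsWalk.singleton v').cons h') ?_ hlt)
    have n1 : u ≠ u' := by rintro rfl; exact lt_irrefl _ hlt
    have n2 : v ≠ v' := by rintro rfl; exact lt_irrefl _ hv
    have n3 : u ≠ v' := by rintro rfl; exact hTS (hT h') (hS h)
    have n4 : v ≠ u' := by rintro rfl; exact hTS (hT h) (hS h')
    simp [n1.symm, n2.symm, n3.symm, n4.symm]
  refine ⟨{ pos := fun v => if v ∈ S then (σ v, 1) else (τ v, 0)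
            arc := fun u v x => (σ u + x * (τ v - σ u), 1 - x)
            arc_continuous := fun _ => by fun_prop
            arc_zero := fun h => by simp [hS h]
            arc_one := fun h => by simp [hTS (hT h)]
            pos_injOn := ?_
            pos_mem := fun {v} _ => by split_ifs <;> simp
            arc_mem := fun _ x => ⟨by linarith [x.2.2], by linarith [x.2.1]⟩
            arc_injective := fun _ x y e => by
              have := congrArg Prod.snd e
              exact Subtype.ext (by simpa using this)
            arc_ne_pos := ?_
            arc_disjoint := ?_ }, fun s hs => posS hs, fun t ht => posT ht⟩
  · rintro x ((hx | hx) | hx) y ((hy | hy) | hy) e <;> try exact absurd ‹_› (Set.notMem_empty _)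
    · dsimp only at e
      rw [posS hx, posS hy] at e
      exact hσ hx hy (congrArg Prod.fst e)
    · dsimp only at e
      rw [posS hx, posT hy] at e
      simp at e
    · dsimp only at e
      rw [posT hx, posS hy] at e
      simp at e
    · dsimp only at e
      rw [posT hx, posT hy] at e
      exact hτ hx hy (congrArg Prod.fst e)
  · rintro u v h x hx w - e
    have e2 := congrArg Prod.snd e
    have h0 : x ≠ 0 := hx.1.ne'
    have h1 : x ≠ 1 := hx.2.ne
    dsimp only at e2
    split_ifs at e2
    · exact h0 ((hx1 x).1.1 (by linarith))
    · exact h1 ((hx1 x).2.1 (by linarith))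
  · intro u v h u' v' h' hne x hx y hy e
    rw [Prod.mk.injEq] at e
    have exy : (x : ℝ) = y := by linarith [e.2]
    rw [← exy] at e
    have hx' : (x : ℝ) ∈ Set.Ioo (0 : ℝ) 1 := hx
    rcases lt_trichotomy (σ u) (σ u') with hlt | heq | hlt
    · exact key h h' x hx' e.1 hlt
    · have h1 : u = u' := hσ (hS h) (hS h') heq
      have h2 : τ v = τ v' := by
        have := e.1
        rw [heq] at this
        have := mul_left_cancel₀ hx'.1.ne' (add_left_cancel this)
        linarith
      exact hne (by rw [h1, hτ (hT h) (hT h') h2])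
    · exact key h' h x hx' e.1.symm hlt
-- Denting the upper side to reinsert edges
/-- The height of the dent `0 ≤ y ≤ (1 + g x) / 2` of width `2 * d` around `c`. -/
noncomputable def dentHeight (c d x : ℝ) : ℝ := min 1 (((x - c) / d) ^ 2)

/-- The map of the strip that pushes a dent of width `2 * d` around `c` into its upper side. -/
noncomputable def dent (c d : ℝ) (z : ℝ × ℝ) : ℝ × ℝ :=
  (z.1, z.2 * ((1 + dentHeight c d z.1) / 2))

theorem dentHeight_nonneg (c d x : ℝ) : 0 ≤ dentHeight c d x := by
  unfold dentHeight; positivity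

theorem dentHeight_le_one (c d x : ℝ) : dentHeight c d x ≤ 1 := min_le_left _ _

theorem dentHeight_eq_one {c d x : ℝ} (hd : 0 < d) (h : d ≤ |x - c|) : dentHeight c d x = 1 := by
  refine min_eq_left ?_
  rw [← sq_abs, abs_div, abs_of_pos hd]
  exact one_le_pow₀ ((one_le_div hd).2 h)

theorem dentHeight_lt_one {c d x : ℝ} (hd : 0 < d) (h : |x - c| < d) : dentHeight c d x < 1 := by
  refine (min_le_right _ _).trans_lt ?_
  rw [← sq_abs, abs_div, abs_of_pos hd]
  exact pow_lt_one₀ (by positivity) ((div_lt_one hd).2 h) two_ne_zero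

/-- The quadratic profile bounds the dent along the segment from (x, 1) to (c, 1/2), where y runs
from 1 to 0. -/
theorem dentHeight_add_mul_le {c d x y : ℝ} (hd : 0 < d) (h : |x - c| ≤ d) :
    dentHeight c d (c + y * (x - c)) ≤ y ^ 2 := by
  refine (min_le_right _ _).trans ?_
  rw [add_sub_cancel_left, mul_div_assoc, mul_pow]
  refine mul_le_of_le_one_right (sq_nonneg _) ?_
  rw [← sq_abs, abs_div, abs_of_pos hd]
  exact pow_le_one₀ (by positivity) ((div_le_one hd).2 h)

theorem continuous_dent (c d : ℝ) : Continuous (dent c d) := by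
  unfold dent dentHeight
  fun_prop

theorem dent_injective (c d : ℝ) : Function.Injective (dent c d) := by
  rintro ⟨x, y⟩ ⟨x', y'⟩ h
  obtain ⟨rfl, h⟩ := Prod.mk.inj h
  have := dentHeight_nonneg c d x
  exact Prod.ext rfl (mul_right_cancel₀ (by positivity) h)

theorem dent_mem {c d : ℝ} {z : ℝ × ℝ} (hz : z.2 ∈ Set.Icc (0 : ℝ) 1) :
    (dent c d z).2 ∈ Set.Icc (0 : ℝ) 1 := by
  have h0 := dentHeight_nonneg c d z.1
  have h1 := dentHeight_le_one c d z.1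
  exact ⟨mul_nonneg hz.1 (by positivity), mul_le_one₀ hz.2 (by positivity) (by linarith)⟩

theorem dent_ne {c d x y : ℝ} {z : ℝ × ℝ} (hz : z.2 ∈ Set.Icc (0 : ℝ) 1)
    (h : (1 + dentHeight c d x) / 2 < y) : dent c d z ≠ (x, y) := by
  rintro e
  obtain ⟨rfl, e⟩ := Prod.mk.inj e
  have h0 := dentHeight_nonneg c d z.1
  have := mul_le_of_le_one_left (by positivity : 0 ≤ (1 + dentHeight c d z.1) / 2) hz.2
  linarith

open Classical in
/-- A drawing in which `v` is a source extends to one in which `v` gets in-neighbours that are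
drawn on the upper side of the strip, in an interval around `v`. -/
theorem StripDrawing.exists_extend {V : Type*} {E : V → V → Prop} {A S : Set V} {v : V}
    {σ : V → ℝ} {c d : ℝ} (hd : 0 < d)
    (D : StripDrawing (fun x y => E x y ∧ y ≠ v) A)
    (hA : ∀ {x y}, E x y → y ≠ v → x ∈ A ∧ y ∈ A)
    (hv : v ∈ A) (hvS : v ∉ S) (hσ : Set.InjOn σ S)
    (hin : ∀ {u}, E u v → u ∈ S ∧ |σ u - c| ≤ d)
    (hDv : D.pos v = (c, 1))
    (hDS : ∀ {s}, s ∈ S → s ∈ A → D.pos s = (σ s, 1) ∧ d ≤ |σ s - c|)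
    (hSA : ∀ {s}, s ∈ S → s ∉ A → |σ s - c| < d) :
    ∃ D' : StripDrawing E (S ∪ A), (∀ s ∈ S, D'.pos s = (σ s, 1)) ∧
      ∀ x ∈ A, D'.pos x = dent c d (D.pos x) := by
  have posS : ∀ {w}, w ∈ S → (if w ∈ S then (σ w, (1 : ℝ)) else dent c d (D.pos w)) = (σ w, 1) :=
    fun h => if_pos h
  -- The two branches agree for a source that was kept, because it lies outside the open dent and is
  -- fixed.
  have posA : ∀ {w}, w ∈ A →
      (if w ∈ S then (σ w, (1 : ℝ)) else dent c d (D.pos w)) = dent c d (D.pos w) := by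
    intro w hw
    split_ifs with h
    · obtain ⟨e, h'⟩ := hDS h hw
      rw [e, dent, dentHeight_eq_one hd h']
      norm_num
    · rfl
  have posv : dent c d (D.pos v) = (c, 1 / 2) := by
    simp [hDv, dent, dentHeight]
  have neS : ∀ {s}, s ∈ S → s ∉ A → ∀ {z : ℝ × ℝ}, z.2 ∈ Set.Icc (0 : ℝ) 1 →
      dent c d z ≠ (σ s, 1) := fun hs hsA _ hz =>
    dent_ne hz (by linarith [dentHeight_lt_one hd (hSA hs hsA)])
  have neL : ∀ {u}, E u v → ∀ x ∈ Set.Ioo (0 : unitInterval) 1, ∀ {z : ℝ × ℝ},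
      z.2 ∈ Set.Icc (0 : ℝ) 1 → dent c d z ≠ (c + (1 - x : ℝ) * (σ u - c), 1 - (x : ℝ) / 2) := by
    intro u hu x hx z hz
    have h0 : (0 : ℝ) < x := hx.1
    have h1 : (x : ℝ) < 1 := hx.2
    refine dent_ne hz ?_
    -- The new edge is strictly above the dent: (1 + (1 - x)²)/2 < 1 - x/2 amounts to (1 - x)² < 1 -
    -- x, true for 0 < x < 1.
    have := dentHeight_add_mul_le (y := 1 - (x : ℝ)) hd (hin hu).2
    nlinarith
  refine ⟨{ pos := fun w => if w ∈ S then (σ w, 1) else dent c d (D.pos w)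
            arc := fun u w x => if w = v then (c + (1 - x : ℝ) * (σ u - c), 1 - (x : ℝ) / 2)
              else dent c d (D.arc u w x)
            arc_continuous := ?_
            arc_zero := ?_
            arc_one := ?_
            pos_injOn := ?_
            pos_mem := ?_
            arc_mem := ?_
            arc_injective := ?_
            arc_ne_pos := ?_
            arc_disjoint := ?_ }, fun s hs => posS hs, fun x hx => posA hx⟩
  · intro u w h
    by_cases hw : w = v
    · simp only [hw, if_true]
      fun_prop
    · simp only [hw, if_false]
      exact (continuous_dent c d).comp (D.arc_continuous ⟨h, hw⟩)
  · intro u w h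
    by_cases hw : w = v
    · subst hw
      simp [(hin h).1]
    · simp only [hw, if_false]
      rw [D.arc_zero ⟨h, hw⟩, posA (hA h hw).1]
  · intro u w h
    by_cases hw : w = v
    · subst hw
      rw [posA hv, posv]
      norm_num
    · simp only [hw, if_false]
      rw [D.arc_one ⟨h, hw⟩, posA (hA h hw).2]
  · have aux : ∀ {x y}, x ∈ S → x ∉ A → y ∈ A → (σ x, (1 : ℝ)) ≠ dent c d (D.pos y) :=
      fun hx hxA hy => (neS hx hxA (D.pos_mem hy)).symm
    intro x hx y hy e
    dsimp only at e
    by_cases hxA : x ∈ A <;> by_cases hyA : y ∈ A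
    · rw [posA hxA, posA hyA] at e
      exact D.pos_injOn hxA hyA (dent_injective c d e)
    · have hyS := hy.resolve_right hyA
      rw [posA hxA, posS hyS] at e
      exact absurd e.symm (aux hyS hyA hxA)
    · have hxS := hx.resolve_right hxA
      rw [posS hxS, posA hyA] at e
      exact absurd e (aux hxS hxA hyA)
    · have hxS := hx.resolve_right hxA
      have hyS := hy.resolve_right hyA
      rw [posS hxS, posS hyS] at e
      exact hσ hxS hyS (congrArg Prod.fst e)
  · intro w hw
    split_ifs with h
    · simp
    · exact dent_mem (D.pos_mem (hw.resolve_left h))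
  · intro u w h x
    split_ifs with hw
    · exact ⟨by linarith [x.2.2], by linarith [x.2.1]⟩
    · exact dent_mem (D.arc_mem ⟨h, hw⟩ x)
  · intro u w h x y e
    split_ifs at e with hw
    · have := congrArg Prod.snd e
      dsimp only at this
      exact Subtype.ext (by linarith)
    · exact D.arc_injective ⟨h, hw⟩ (dent_injective c d e)
  · intro u w h x hx z hz e
    by_cases hw : w = v
    · subst hw
      rw [if_pos rfl] at e
      by_cases hzA : z ∈ A
      · rw [posA hzA] at e
        exact neL h x hx (D.pos_mem hzA) e.symm
      · rw [posS (hz.resolve_right hzA)] at e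
        have h0 : (0 : ℝ) < x := hx.1
        have := congrArg Prod.snd e
        dsimp only at this
        linarith
    · rw [if_neg hw] at e
      by_cases hzA : z ∈ A
      · rw [posA hzA] at e
        exact D.arc_ne_pos ⟨h, hw⟩ x hx z hzA (dent_injective c d e)
      · have hzS := hz.resolve_right hzA
        rw [posS hzS] at e
        exact neS hzS hzA (D.arc_mem ⟨h, hw⟩ x) e
  · intro u w h u' w' h' hne x hx y hy e
    by_cases hw : w = v <;> by_cases hw' : w' = v
    · subst hw hw'
      rw [if_pos rfl, if_pos rfl, Prod.mk.injEq] at e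
      have exy : (x : ℝ) = y := by linarith [e.2]
      have h1 : (1 - y : ℝ) ≠ 0 := (sub_pos.2 (show (y : ℝ) < 1 from hy.2)).ne'
      have e1 := e.1
      rw [exy] at e1
      have := mul_left_cancel₀ h1 (add_left_cancel e1)
      exact hne (by rw [hσ (hin h).1 (hin h').1 (sub_left_inj.1 this)])
    · subst hw
      rw [if_pos rfl, if_neg hw'] at e
      exact neL h x hx (D.arc_mem ⟨h', hw'⟩ y) e.symm
    · subst hw'
      rw [if_pos rfl, if_neg hw] at e
      exact neL h' y hy (D.arc_mem ⟨h, hw⟩ x) e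
    · rw [if_neg hw, if_neg hw'] at e
      exact D.arc_disjoint ⟨h, hw⟩ ⟨h', hw'⟩ hne x hx y hy (dent_injective c d e)

/-- A layered graph without crossing walks can be drawn in the strip with the sources and the sinks
at their given coordinates. -/
theorem Layered.exists_stripDrawing {V : Type*} [Finite V] {E : V → V → Prop} {S I T : Set V}
    {r : V → ℕ} (hL : Layered E S I T r) {σ τ : V → ℝ} (hσ : Set.InjOn σ S) (hτ : Set.InjOn τ T)
    (hE : NoCrossing E S T σ τ) :
    ∃ D : StripDrawing E (S ∪ I ∪ T),
      (∀ s ∈ S, D.pos s = (σ s, 1)) ∧ ∀ t ∈ T, D.pos t = (τ t, 0) := by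
  classical
  obtain ⟨n, hn⟩ : ∃ n, I.ncard = n := ⟨_, rfl⟩
  induction n generalizing E S I σ with
  | zero =>
    rw [Set.ncard_eq_zero] at hn
    subst hn
    exact hL.exists_stripDrawing_of_empty hσ hτ hE
  | succ n ih =>
    obtain ⟨v, hv, hmin⟩ := Set.exists_min_image I r I.toFinite
      (Set.nonempty_of_ncard_ne_zero (by omega))
    have hin : ∀ u, E u v → u ∈ S := fun u hu =>
      (hL.tail_mem hu).resolve_right fun h => (hmin u h).not_gt (hL.lt hu)
    obtain ⟨u, u', hne, hu, hu'⟩ := hL.two_in hv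
    obtain ⟨a, ha, hamin⟩ := Set.exists_min_image {u | E u v} σ (Set.toFinite _) ⟨u, hu⟩
    obtain ⟨b, hb, hbmax⟩ := Set.exists_max_image {u | E u v} σ (Set.toFinite _) ⟨u, hu⟩
    have hab : σ a < σ b := by
      rcases lt_or_gt_of_ne (fun e => hne (hσ (hin u hu) (hin u' hu') e)) with h | h
      · exact (hamin u hu).trans_lt (h.trans_le (hbmax u' hu'))
      · exact (hamin u' hu').trans_lt (h.trans_le (hbmax u hu))
    -- The dent spans exactly the interval from σ a to σ b, so its interior contains the coordinates
    -- of exactly the dropped sources.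
    obtain ⟨c, hc⟩ : ∃ c, c = (σ a + σ b) / 2 := ⟨_, rfl⟩
    obtain ⟨d, hd⟩ : ∃ d, d = (σ b - σ a) / 2 := ⟨_, rfl⟩
    have hvS : v ∉ S := hL.notMem_S (Or.inl hv)
    have hup : ∀ {s}, s ∈ S → Function.update σ v c s = σ s := fun {s} hs =>
      Function.update_of_ne (fun e : s = v => hvS (e ▸ hs)) _ _
    obtain ⟨D, hDS, hDT⟩ := ih (hL.delete_edges hτ hE hv hin ha hb) (σ := Function.update σ v c)
      (by
        rintro x (rfl | hx) y (rfl | hy) e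
        · rfl
        · rw [Function.update_self, hup hy.1] at e
          exact absurd ⟨by linarith, by linarith⟩ hy.2
        · rw [Function.update_self, hup hx.1] at e
          exact absurd ⟨by linarith, by linarith⟩ hx.2
        · rw [hup hx.1, hup hy.1] at e
          exact hσ hx.1 hy.1 e)
      (hL.noCrossing_delete_edges hE hv hin ha hb (by linarith) (by linarith))
      (by rw [Set.ncard_sdiff_singleton_of_mem hv]; omega)
    have hSA : ∀ {s}, s ∈ S → (s ∈ insert v {s ∈ S | ¬ (σ a < σ s ∧ σ s < σ b)} ∪ I \ {v} ∪ T ↔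
        ¬ (σ a < σ s ∧ σ s < σ b)) := by
      intro s hs
      constructor
      · rintro (((rfl | h) | h) | h)
        · exact absurd hs hvS
        · exact h.2
        · exact absurd hs (hL.notMem_S (Or.inl h.1))
        · exact absurd hs (hL.notMem_S (Or.inr h))
      · exact fun h => Or.inl (Or.inl (Or.inr ⟨hs, h⟩))
    have habs : ∀ {s}, (σ a < σ s ∧ σ s < σ b) ↔ |σ s - c| < d := by
      intro s
      rw [abs_lt]
      constructor <;> rintro ⟨h1, h2⟩ <;> constructor <;> linarith
    have hLD := hL.delete_edges hτ hE hv hin ha hb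
    obtain ⟨D', hS', hA'⟩ := D.exists_extend (S := S) (σ := σ) (c := c) (d := d) (by linarith)
      (fun {x y} h h' => ⟨Or.inl (hLD.tail_mem ⟨h, h'⟩), by
        rcases hLD.head_mem ⟨h, h'⟩ with h | h
        · exact Or.inl (Or.inr h)
        · exact Or.inr h⟩)
      (Or.inl (Or.inl (Or.inl rfl))) hvS hσ
      (fun {u} hu => ⟨hin u hu, abs_le.2 ⟨by linarith [hamin u hu], by linarith [hbmax u hu]⟩⟩)
      (by rw [hDS v (Or.inl rfl), Function.update_self])
      (fun {s} hs hsA => by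
        have h := (hSA hs).1 hsA
        refine ⟨by rw [hDS s (Or.inr ⟨hs, h⟩), hup hs], ?_⟩
        rwa [habs, not_lt] at h)
      (fun {s} hs hsA => by
        rw [hSA hs, not_not] at hsA
        exact habs.1 hsA)
    have hset : S ∪ (insert v {s ∈ S | ¬ (σ a < σ s ∧ σ s < σ b)} ∪ I \ {v} ∪ T) =
        S ∪ I ∪ T := by
      ext x
      by_cases hxv : x = v
      · simp [hxv, hv]
      · simp only [Set.mem_union, Set.mem_insert_iff, Set.mem_sdiff, Set.mem_singleton_iff,
          Set.mem_sep_iff, hxv]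
        tauto
    rw [← hset]
    -- The dent scales heights, so it fixes the sinks at height 0.
    exact ⟨D', hS', fun t ht => by rw [hA' t (Or.inr ht), hDT t ht]; simp [dent]⟩

/-! ### From the strip to the disc -/

/-- The map of the strip `0 ≤ y ≤ 1` onto the closed unit disc without `-1` and `1`. -/
noncomputable def stripToDisc (z : ℝ × ℝ) : ℂ :=
  ⟨z.1 / √(1 + z.1 ^ 2), (2 * z.2 - 1) / √(1 + z.1 ^ 2)⟩

theorem continuous_stripToDisc : Continuous stripToDisc := by
  have h : ∀ z : ℝ × ℝ, √(1 + z.1 ^ 2) ≠ 0 := fun z => by positivity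
  have : stripToDisc = fun z => ((z.1 / √(1 + z.1 ^ 2) : ℝ) : ℂ) +
      (((2 * z.2 - 1) / √(1 + z.1 ^ 2) : ℝ) : ℂ) * Complex.I := by
    funext z
    exact Complex.mk_eq_add_mul_I _ _
  rw [this]
  have h1 : Continuous fun z : ℝ × ℝ => z.1 / √(1 + z.1 ^ 2) :=
    Continuous.div (by fun_prop) (by fun_prop) h
  have h2 : Continuous fun z : ℝ × ℝ => (2 * z.2 - 1) / √(1 + z.1 ^ 2) :=
    Continuous.div (by fun_prop) (by fun_prop) h
  fun_prop

/-- The abscissa sin(arctan x) determines x; on the vertical line over it the map is affine in y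
with nonzero slope. -/
theorem stripToDisc_injective : Function.Injective stripToDisc := by
  rintro ⟨x, y⟩ ⟨x', y'⟩ h
  obtain ⟨h1, h2⟩ := Complex.ext_iff.1 h
  dsimp only [stripToDisc] at h1 h2
  have hx : x = x' := by
    rw [← Real.sin_arctan, ← Real.sin_arctan] at h1
    exact Real.sin_arctan_strictMono.injective h1
  subst hx
  have := (div_left_inj' (by positivity : √(1 + x ^ 2) ≠ 0)).1 h2
  exact Prod.ext rfl (by linarith)

theorem stripToDisc_mem {z : ℝ × ℝ} (hz : z.2 ∈ Set.Icc (0 : ℝ) 1) :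
    stripToDisc z ∈ Metric.closedBall (0 : ℂ) 1 := by
  rw [mem_closedBall_zero_iff, ← sq_le_one_iff₀ (norm_nonneg _), ← Complex.normSq_eq_norm_sq,
    Complex.normSq_apply]
  dsimp only [stripToDisc]
  rw [← sq, ← sq, div_pow, div_pow, Real.sq_sqrt (by positivity), ← add_div,
    div_le_one (by positivity)]
  nlinarith [hz.1, hz.2]

theorem stripToDisc_one (x : ℝ) :
    stripToDisc (x, 1) = Complex.exp ((Real.pi / 2 - Real.arctan x : ℝ) * Complex.I) := by
  apply Complex.ext
  · rw [Complex.exp_ofReal_mul_I_re, Real.cos_pi_div_two_sub, Real.sin_arctan]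
    rfl
  · rw [Complex.exp_ofReal_mul_I_im, Real.sin_pi_div_two_sub, Real.cos_arctan]
    norm_num [stripToDisc]

theorem stripToDisc_zero (x : ℝ) :
    stripToDisc (x, 0) = Complex.exp ((Real.arctan x - Real.pi / 2 : ℝ) * Complex.I) := by
  apply Complex.ext
  · rw [Complex.exp_ofReal_mul_I_re, Real.cos_sub_pi_div_two, Real.sin_arctan]
    rfl
  · rw [Complex.exp_ofReal_mul_I_im, Real.sin_sub_pi_div_two, Real.cos_arctan]
    norm_num [stripToDisc, neg_div]

namespace Digraph

variable {V : Type*} {G : Digraph V}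

/-- The drawing in the disc that is obtained from a drawing in the strip. -/
noncomputable def discDrawingOfStrip {A : Set V} (D : StripDrawing G.Adj A) (hA : ∀ v, v ∈ A) :
    G.DiscDrawing where
  pos v := stripToDisc (D.pos v)
  arc u v h :=
    { toFun := fun x => stripToDisc (D.arc u v x)
      continuous_toFun := continuous_stripToDisc.comp (D.arc_continuous h)
      source' := by rw [D.arc_zero h]
      target' := by rw [D.arc_one h] }
  pos_mem v := stripToDisc_mem (D.pos_mem (hA v))
  pos_injective u v h := D.pos_injOn (hA u) (hA v) (stripToDisc_injective h)
  arc_mem _ _ h x := stripToDisc_mem (D.arc_mem h x)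
  arc_injective _ _ h := stripToDisc_injective.comp (D.arc_injective h)
  arc_ne_pos _ _ h x hx w e := D.arc_ne_pos h x hx w (hA w) (stripToDisc_injective e)
  arc_disjoint _ _ h _ _ h' hne x hx y hy e :=
    D.arc_disjoint h h' hne x hx y hy (stripToDisc_injective e)

/-! ### Rank function and assembly -/

/-- An acyclic digraph on finitely many vertices has a rank function that increases along the
edges. -/
theorem Acyclic.exists_rank [Finite V] (hG : G.Acyclic) :
    ∃ r : V → ℕ, ∀ u v, G.Adj u v → r u < r v := by
  classical
  have := Fintype.ofFinite V
  -- The rank of v will be `Fintype.card V` minus the number of vertices of a longest dipath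
  -- starting at v.
  let L : V → Set ℕ := fun v =>
    {n | ∃ (w : V) (p : List V), p.Nodup ∧ IsWalk G.Adj v w p ∧ p.length = n}
  have hne : ∀ v, (L v).Nonempty := fun v => ⟨1, v, [v], by simp, .singleton v, rfl⟩
  have hbdd : ∀ v, BddAbove (L v) := fun v => ⟨Fintype.card V, by
    rintro n ⟨w, p, hp, -, rfl⟩
    exact hp.length_le_card⟩
  let h : V → ℕ := fun v => sSup (L v)
  have hlt : ∀ u v, G.Adj u v → h v < h u := by
    intro u v huv
    obtain ⟨w, p, hp, hw, hlen⟩ := Nat.sSup_mem (hne v) (hbdd v)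
    -- If `u` lies on `p`, the part of `p` up to `u` is closed to a directed cycle by the edge from
    -- `u` to `v`; otherwise `u` can be prepended.
    by_cases hu : u ∈ p
    · exfalso
      obtain ⟨p₁, p₂, rfl⟩ := List.append_of_mem hu
      refine hG (p₁ ++ [u]) ⟨?_, ?_, by simp, ?_⟩
      · exact hp.sublist (by simp)
      · have := hw.1
        rw [List.append_cons] at this
        exact (List.isChain_append.1 this).1
      · have h1 := hw.2.1
        have h2 : (p₁ ++ [u]).head (by simp) = v := by
          cases p₁ <;> simpa using h1
        rw [h2]
        simpa using huv
    · have : p.length + 1 ≤ h u :=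
        le_csSup (hbdd u) ⟨w, u :: p, List.nodup_cons.2 ⟨hu, hp⟩, hw.cons huv, rfl⟩
      change p.length = h v at hlen
      omega
  have hle : ∀ v, h v ≤ Fintype.card V := fun v => by
    obtain ⟨w, p, hp, -, hlen⟩ := Nat.sSup_mem (hne v) (hbdd v)
    change p.length = h v at hlen
    exact hlen ▸ hp.length_le_card
  refine ⟨fun v => Fintype.card V - h v, fun u v huv => ?_⟩
  have := hlt u v huv
  have := hle u
  dsimp only
  omega

theorem exists_two_of_two_le_ncard {α : Type*} {s : Set α} (h : 2 ≤ s.ncard) :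
    ∃ a b, a ≠ b ∧ a ∈ s ∧ b ∈ s := by
  obtain ⟨a, ha, b, hb, hab⟩ := (Set.one_lt_ncard_iff_nontrivial_and_finite.1 h).1
  exact ⟨a, b, hab, ha, hb⟩

theorem isDipath_of_isWalk {r : V → ℕ} (hr : ∀ u v, G.Adj u v → r u < r v) {u v : V} {p : List V}
    (hp : IsWalk G.Adj u v p) : G.IsDipath u v p := by
  obtain ⟨h1, h2, h3⟩ := hp
  have hne : p ≠ [] := by rintro rfl; simp at h2
  refine ⟨?_, h1, hne, ?_, ?_⟩
  · have : p.Pairwise fun a b => r a < r b := by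
      have h := h1.imp (S := fun a b => r a < r b) hr
      have : Trans (fun a b : V => r a < r b) (fun a b => r a < r b) (fun a b => r a < r b) :=
        ⟨fun h h' => lt_trans h h'⟩
      exact List.isChain_iff_pairwise.1 h
    exact this.imp fun h e => by simp [e] at h
  · rw [List.head?_eq_some_head hne] at h2
    exact Option.some_inj.1 h2
  · rw [List.getLast?_eq_some_getLast hne] at h3
    exact Option.some_inj.1 h3

/-- Without a cross, the digraph can be drawn in the disc. -/
theorem drawableInDisc_of_not_hasCross [Finite V] (hG : G.Acyclic)
    {k l : ℕ} (s : Fin k → V) (t : Fin l → V)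
    (hs : Function.Injective s) (hS : Set.range s = G.sources)
    (ht : Function.Injective t) (hT : Set.range t = G.sinks)
    (hST : Set.range s ∩ Set.range t = ∅)
    (hdeg : ∀ v : V, v ∉ Set.range s ∪ Set.range t → 2 ≤ G.inDeg v ∧ 2 ≤ G.outDeg v)
    (hcross : ¬ G.HasCross s t) :
    G.DrawableInDisc (Fin.append s (fun j => t (Fin.rev j))) := by
  obtain ⟨r, hr⟩ := hG.exists_rank
  have hL : Layered G.Adj (Set.range s) (Set.range s ∪ Set.range t)ᶜ (Set.range t) r :=
    { tail_mem := fun {u v} h => or_iff_not_imp_left.2 fun hu => not_or.2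
        ⟨hu, fun hu' => by rw [hT] at hu'; exact hu' v h⟩
      head_mem := fun {u v} h => or_iff_not_imp_right.2 fun hv => not_or.2
        ⟨fun hv' => by rw [hS] at hv'; exact hv' u h, hv⟩
      lt := hr _ _
      disjoint_SI := disjoint_compl_right.mono_left Set.subset_union_left
      disjoint_ST := Set.disjoint_iff_inter_eq_empty.2 hST
      disjoint_IT := disjoint_compl_left.mono_right Set.subset_union_right
      two_in := fun hv => exists_two_of_two_le_ncard (hdeg _ hv).1
      two_out := fun hv => exists_two_of_two_le_ncard (hdeg _ hv).2 }
  obtain ⟨σ, hσ⟩ : ∃ σ : V → ℝ, ∀ i, σ (s i) = (i : ℕ) :=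
    ⟨Function.extend s (fun i => ((i : ℕ) : ℝ)) 0, fun i => hs.extend_apply _ _ _⟩
  obtain ⟨τ, hτ⟩ : ∃ τ : V → ℝ, ∀ j, τ (t j) = (j : ℕ) :=
    ⟨Function.extend t (fun j => ((j : ℕ) : ℝ)) 0, fun j => ht.extend_apply _ _ _⟩
  have hE : NoCrossing G.Adj (Set.range s) (Set.range t) σ τ := by
    rintro _ ⟨i, rfl⟩ _ ⟨i', rfl⟩ _ ⟨j, rfl⟩ _ ⟨j', rfl⟩ p p' hp hp' hd hlt
    rw [hσ, hσ, Nat.cast_lt] at hlt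
    rw [hτ, hτ, Nat.cast_le]
    by_contra hj
    exact hcross ⟨i, i', j, j', p, p', isDipath_of_isWalk hr hp, isDipath_of_isWalk hr hp', hd,
      Or.inl ⟨hlt, not_le.1 hj⟩⟩
  obtain ⟨D, hDs, hDt⟩ := hL.exists_stripDrawing (σ := σ) (τ := τ)
    (by
      rintro _ ⟨i, rfl⟩ _ ⟨i', rfl⟩ e
      rw [hσ, hσ, Nat.cast_inj] at e
      rw [Fin.ext e])
    (by
      rintro _ ⟨i, rfl⟩ _ ⟨i', rfl⟩ e
      rw [hτ, hτ, Nat.cast_inj] at e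
      rw [Fin.ext e]) hE
  -- These are the angles from `stripToDisc_one` and `stripToDisc_zero`. They decrease along the
  -- list, so the boundary is traversed clockwise.
  refine ⟨discDrawingOfStrip D fun v => ?_, Fin.append
    (fun i => Real.pi / 2 - Real.arctan (i : ℕ))
    (fun j => Real.arctan (j.rev : ℕ) - Real.pi / 2), Or.inr ?_, ?_, ?_⟩
  · simp only [Set.mem_union, Set.mem_compl_iff]
    tauto
  · intro i j hij
    induction i using Fin.addCases with
    | left i =>
      induction j using Fin.addCases with
      | left j =>
        rw [Fin.append_left, Fin.append_left]
        exact sub_lt_sub_left (Real.arctan_strictMono (Nat.cast_lt.2 hij)) _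
      | right j =>
        rw [Fin.append_left, Fin.append_right]
        linarith [Real.arctan_lt_pi_div_two (i : ℕ), Real.arctan_lt_pi_div_two (j.rev : ℕ)]
    | right i =>
      induction j using Fin.addCases with
      | left j =>
        rw [Fin.lt_def, Fin.val_natAdd, Fin.val_castAdd] at hij
        omega
      | right j =>
        rw [Fin.append_right, Fin.append_right]
        refine sub_lt_sub_right (Real.arctan_strictMono (Nat.cast_lt.2 ?_)) _
        exact Fin.rev_lt_rev.2 (by simpa using hij)
  · have h : ∀ i, |Fin.append (fun i : Fin k => Real.pi / 2 - Real.arctan (i : ℕ))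
        (fun j : Fin l => Real.arctan (j.rev : ℕ) - Real.pi / 2) i| < Real.pi := by
      intro i
      induction i using Fin.addCases with
      | left i =>
        rw [Fin.append_left, abs_lt]
        constructor <;> linarith [Real.arctan_lt_pi_div_two (i : ℕ),
          Real.neg_pi_div_two_lt_arctan (i : ℕ), Real.pi_pos]
      | right j =>
        rw [Fin.append_right, abs_lt]
        constructor <;> linarith [Real.arctan_lt_pi_div_two (j.rev : ℕ),
          Real.neg_pi_div_two_lt_arctan (j.rev : ℕ), Real.pi_pos]
    intro i j
    linarith [abs_sub (Fin.append (fun i : Fin k => Real.pi / 2 - Real.arctan (i : ℕ))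
        (fun j : Fin l => Real.arctan (j.rev : ℕ) - Real.pi / 2) i)
        (Fin.append (fun i : Fin k => Real.pi / 2 - Real.arctan (i : ℕ))
        (fun j : Fin l => Real.arctan (j.rev : ℕ) - Real.pi / 2) j), h i, h j]
  · intro i
    change stripToDisc (D.pos _) = _
    induction i using Fin.addCases with
    | left i =>
      rw [Fin.append_left, Fin.append_left, hDs _ ⟨i, rfl⟩, hσ, stripToDisc_one]
    | right j =>
      rw [Fin.append_right, Fin.append_right, hDt _ ⟨_, rfl⟩, hτ, stripToDisc_zero]

end Digraph

theorem theorem2 {V : Type*} [Finite V] (G : Digraph V) (hG : G.Acyclic)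
    {k l : ℕ} (s : Fin k → V) (t : Fin l → V)
    (hs : Function.Injective s) (hS : Set.range s = G.sources)
    (ht : Function.Injective t) (hT : Set.range t = G.sinks)
    (hST : Set.range s ∩ Set.range t = ∅)
    (hdeg : ∀ v : V, v ∉ Set.range s ∪ Set.range t → 2 ≤ G.inDeg v ∧ 2 ≤ G.outDeg v) :
    Xor (G.HasCross s t) (G.DrawableInDisc (Fin.append s (fun j => t (Fin.rev j)))) := by
  by_cases h : G.HasCross s t
  · exact Or.inl ⟨h, h.not_drawableInDisc⟩
  · exact Or.inr ⟨Digraph.drawableInDisc_of_not_hasCross hG s t hs hS ht hT hST hdeg h, h⟩
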